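/- Let $\mathbb D=\{u\in\mathbb R^2:\|u\|<1\}$ be the Poincar\'e disk, with hyperbolic distance $\operatorname{dist}_{\mathbb H}(u,v)=2\operatorname{arcsinh}\Big(\frac{\|u-v\|}{\sqrt{(1-\|u\|^2)(1-\|v\|^2)}}\Big)$ and hyperbolic area $\operatorname{area}_{\mathbb H}(A)=\int_A\frac{4}{(1-\|u\|^2)^2}\,du$ for measurable $A\subseteq\mathbb D$. Let $\lambda>0$ and let $\mathcal Z\subseteq\mathbb D$ be a Poisson point process of constant intensity $\lambda$ with respect to $\operatorname{area}_{\mathbb H}$: for every measurable $A\subseteq\mathbb D$ the number $|\mathcal Z\cap A|$ is Poisson distributed with mean $\lambda\operatorname{area}_{\mathbb H}(A)$ (almost surely infinite if the mean is infinite), and for disjoint measurable $A_1,\dots,A_m\subseteq\mathbb D$ the numbers $|\mathcal Z\cap A_1|,\dots,|\mathcal Z\cap A_m|$ are independent. For $z\in\mathcal Z$ define the Euclidean and hyperbolic Voronoi cells $$C_{\mathbb R}(z)=\{u\in\mathbb R^2:\|u-z\|=\inf_{z'\in\mathcal Z}\|u-z'\|\},\qquad C_{\mathbb H}(z)=\{u\in\mathbb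 D:\operatorname{dist}_{\mathbb H}(u,z)=\inf_{z'\in\mathcal Z}\operatorname{dist}_{\mathbb H}(u,z')\},$$ and say that two cells touch if they have a point in common. Then, almost surely, for all $z_1,z_2\in\mathcal Z$, the cells $C_{\mathbb R}(z_1)$ and $C_{\mathbb R}(z_2)$ touch if and only if the cells $C_{\mathbb H}(z_1)$ and $C_{\mathbb H}(z_2)$ touch. -/

import Mathlib

open MeasureTheory ProbabilityTheory
open scoped ENNReal NNReal

noncomputable section

namespace HypVoronoi

/-- The Euclidean plane. -/
abbrev Plane : Type := EuclideanSpace ℝ (Fin 2)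

/-- The open unit disk, the underlying set of the Poincaré disk model. -/
def Dee : Set Plane := Metric.ball 0 1

/-- The hyperbolic distance of the Poincaré disk model, for points `u`, `v` of the unit disk. -/
def distH (u v : Plane) : ℝ :=
  2 * Real.arsinh (‖u - v‖ / √((1 - ‖u‖ ^ 2) * (1 - ‖v‖ ^ 2)))

/-- The hyperbolic area of a measurable subset `A` of the unit disk. -/
def areaH (A : Set Plane) : ℝ≥0∞ :=
  ∫⁻ u in A, ENNReal.ofReal (4 / (1 - ‖u‖ ^ 2) ^ 2)

/-- The hyperbolic Voronoi cell of `z` with respect to the point set `Z`. -/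
def cellH (Z : Set Plane) (z : Plane) : Set Plane :=
  {u | u ∈ Dee ∧ distH u z = ⨅ z' : Z, distH u z'}

/-- The Euclidean Voronoi cell of `z` with respect to the point set `Z`, as a subset of the
whole plane. -/
def cellR (Z : Set Plane) (z : Plane) : Set Plane :=
  {u | ‖u - z‖ = ⨅ z' : Z, ‖u - (z' : Plane)‖}

/-- Two cells touch if they have a point in common. -/
def Touch (C D : Set Plane) : Prop := (C ∩ D).Nonempty

/-- The Poisson distribution with mean `r ∈ [0, ∞]`, as a measure on `ℕ∞`. A Poisson variable
with infinite mean is almost surely infinite. -/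
def poissonLaw (r : ℝ≥0∞) : Measure ℕ∞ :=
  if r = ∞ then Measure.dirac ⊤ else (poissonMeasure r.toNNReal).map ((↑) : ℕ → ℕ∞)

/-- The number of points of `Z` in `A`. -/
def count (Z A : Set Plane) : ℕ∞ := (Z ∩ A).encard

/-- `Z` is a homogeneous Poisson point process of intensity `lam` on the hyperbolic plane,
in the Poincaré disk model, defined on the probability space `(Ω, P)`. -/
structure IsHyperbolicPPP {Ω : Type*} [MeasurableSpace Ω] (P : Measure Ω) (lam : ℝ)
    (Z : Ω → Set Plane) : Prop where
  /-- The points lie in the unit disk. -/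
  subset_disk : ∀ ω, Z ω ⊆ Dee
  /-- The number of points in a measurable set is a random variable. -/
  measurable_count : ∀ A : Set Plane, MeasurableSet A → A ⊆ Dee →
    Measurable fun ω => count (Z ω) A
  /-- The number of points in `A` is Poisson distributed with mean `lam * areaH A`. -/
  law_count : ∀ A : Set Plane, MeasurableSet A → A ⊆ Dee →
    P.map (fun ω => count (Z ω) A) = poissonLaw (ENNReal.ofReal lam * areaH A)
  /-- The numbers of points in finitely many disjoint sets are independent. -/
  indep_count : ∀ (m : ℕ) (A : Fin m → Set Plane), (∀ i, MeasurableSet (A i)) →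
    (∀ i, A i ⊆ Dee) → (∀ i j, i ≠ j → Disjoint (A i) (A j)) →
    iIndepFun (fun i ω => count (Z ω) (A i)) P

end HypVoronoi

end

/-!
Hyperbolic disks are exactly the Euclidean disks whose closure lies in the unit disk. Two Voronoi
cells touch, in either geometry, precisely when the two nuclei lie on the boundary of a disk of that
geometry without points of `Z` inside, so the two relations can differ only through an empty
Euclidean disk that reaches the unit circle. Such a disk contains a horodisk, and almost surely
there is no empty horodisk: shrinking a horodisk of Euclidean radius `s` by `ε` leaves hyperbolic
area of order `√(s / ε)`, hence emptiness of probability `exp (-const / √ε)`, which beats the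
`O(1 / ε)` tangency points that suffice to approximate all horodisks of that radius.
-/

open MeasureTheory ProbabilityTheory Filter Topology Metric
open scoped ENNReal NNReal

namespace HypVoronoi

/-! ### Hyperbolic disks are Euclidean disks -/

theorem mem_Dee {u : Plane} : u ∈ Dee ↔ ‖u‖ < 1 := mem_ball_zero_iff

theorem one_sub_norm_sq_pos {E : Type*} [SeminormedAddGroup E] {u : E} (hu : ‖u‖ < 1) :
    0 < 1 - ‖u‖ ^ 2 :=
  sub_pos.2 (pow_lt_one₀ (norm_nonneg u) hu two_ne_zero)

theorem distH_nonneg (u v : Plane) : 0 ≤ distH u v :=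
  mul_nonneg zero_le_two (Real.arsinh_nonneg_iff.2 (by positivity))

theorem sinh_half_distH_sq_mul {u v : Plane} (hu : u ∈ Dee) (hv : v ∈ Dee) :
    Real.sinh (distH u v / 2) ^ 2 * ((1 - ‖u‖ ^ 2) * (1 - ‖v‖ ^ 2)) = ‖u - v‖ ^ 2 := by
  have hu' := one_sub_norm_sq_pos (mem_Dee.1 hu)
  have hv' := one_sub_norm_sq_pos (mem_Dee.1 hv)
  rw [distH, mul_div_cancel_left₀ _ two_ne_zero, Real.sinh_arsinh, div_pow,
    Real.sq_sqrt (by positivity), div_mul_cancel₀ _ (by positivity)]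

theorem distH_lt_iff {u v : Plane} (hu : u ∈ Dee) (hv : v ∈ Dee) {ρ : ℝ} (hρ : 0 ≤ ρ) :
    distH u v < ρ ↔
      ‖u - v‖ ^ 2 < Real.sinh (ρ / 2) ^ 2 * ((1 - ‖u‖ ^ 2) * (1 - ‖v‖ ^ 2)) := by
  have hu' := one_sub_norm_sq_pos (mem_Dee.1 hu)
  have hv' := one_sub_norm_sq_pos (mem_Dee.1 hv)
  have hd := distH_nonneg u v
  rw [← sinh_half_distH_sq_mul hu hv, mul_lt_mul_iff_left₀ (by positivity),
    sq_lt_sq₀ (Real.sinh_nonneg_iff.2 (by positivity)) (Real.sinh_nonneg_iff.2 (by positivity)),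
    Real.sinh_lt_sinh, div_lt_div_iff_of_pos_right two_pos]

theorem distH_eq_iff {u v : Plane} (hu : u ∈ Dee) (hv : v ∈ Dee) {ρ : ℝ} (hρ : 0 ≤ ρ) :
    distH u v = ρ ↔
      ‖u - v‖ ^ 2 = Real.sinh (ρ / 2) ^ 2 * ((1 - ‖u‖ ^ 2) * (1 - ‖v‖ ^ 2)) := by
  have hu' := one_sub_norm_sq_pos (mem_Dee.1 hu)
  have hv' := one_sub_norm_sq_pos (mem_Dee.1 hv)
  have hd := distH_nonneg u v
  rw [← sinh_half_distH_sq_mul hu hv, mul_left_inj' (by positivity),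
    sq_eq_sq₀ (Real.sinh_nonneg_iff.2 (by positivity)) (Real.sinh_nonneg_iff.2 (by positivity)),
    Real.sinh_inj, div_left_inj' two_ne_zero]

/-- The open hyperbolic disk with hyperbolic centre `u` and hyperbolic radius `ρ`. -/
def ballH (u : Plane) (ρ : ℝ) : Set Plane := {v | v ∈ Dee ∧ distH u v < ρ}

/-- The hyperbolic circle with hyperbolic centre `u` and hyperbolic radius `ρ`. -/
def sphereH (u : Plane) (ρ : ℝ) : Set Plane := {v | v ∈ Dee ∧ distH u v = ρ}

-- The left side compares `v` with a hyperbolic circle about `u` (see `distH_lt_iff`), the right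
-- side with a Euclidean circle about `x • u`.
theorem mul_norm_sub_sq_sub_eq {E : Type*} [NormedAddCommGroup E] [InnerProductSpace ℝ E]
    (u v : E) (x : ℝ) :
    x * ‖u - v‖ ^ 2 - (1 - x) * (1 - ‖v‖ ^ 2) =
      ‖v - x • u‖ ^ 2 - (1 - x) * (1 - x * ‖u‖ ^ 2) := by
  rw [norm_sub_sq_real, norm_sub_sq_real, norm_smul, mul_pow, Real.norm_eq_abs, sq_abs,
    real_inner_smul_right, real_inner_comm]
  ring

theorem mul_add_lt_one_of_sq_eq {a x r : ℝ} (ha₀ : 0 ≤ a) (ha : a < 1) (hx₀ : 0 < x) (hx : x ≤ 1)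
    (hr : r ^ 2 = (1 - x) * (1 - x * a ^ 2)) : x * a + r < 1 := by
  have hxa : 0 ≤ 1 - x * a := sub_nonneg.2 (mul_le_one₀ hx ha₀ ha.le)
  have hlt : r ^ 2 < (1 - x * a) ^ 2 := by
    rw [← sub_pos, hr]
    calc 0 < x * (1 - a) ^ 2 := mul_pos hx₀ (pow_pos (sub_pos.2 ha) 2)
      _ = (1 - x * a) ^ 2 - (1 - x) * (1 - x * a ^ 2) := by ring
  linarith [lt_of_pow_lt_pow_left₀ 2 hxa hlt]

section EuclideanDisk

variable {u : Plane} {ρ x r : ℝ}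

theorem ballH_eq_ball_and_sphereH_eq_sphere (hu : u ∈ Dee) (hρ : 0 ≤ ρ) (hr₀ : 0 ≤ r)
    (hx : x * (1 + Real.sinh (ρ / 2) ^ 2 * (1 - ‖u‖ ^ 2)) = 1)
    (hr : r ^ 2 = (1 - x) * (1 - x * ‖u‖ ^ 2)) :
    ‖x • u‖ + r < 1 ∧ ballH u ρ = ball (x • u) r ∧ sphereH u ρ = sphere (x • u) r := by
  have hu' := one_sub_norm_sq_pos (mem_Dee.1 hu)
  have hx₀ : 0 < x := pos_of_mul_pos_left (hx ▸ one_pos) (by positivity)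
  have hx₁ : x ≤ 1 := by
    have : 0 ≤ x * (Real.sinh (ρ / 2) ^ 2 * (1 - ‖u‖ ^ 2)) := by positivity
    linarith
  have hlt : ‖x • u‖ + r < 1 := by
    rw [norm_smul, Real.norm_of_nonneg hx₀.le]
    exact mul_add_lt_one_of_sq_eq (norm_nonneg u) (mem_Dee.1 hu) hx₀ hx₁ hr
  have hDee : closedBall (x • u) r ⊆ Dee :=
    closedBall_subset_ball' (by rwa [dist_zero_right, add_comm])
  have hpencil (v : Plane) :
      x * (‖u - v‖ ^ 2 - Real.sinh (ρ / 2) ^ 2 * ((1 - ‖u‖ ^ 2) * (1 - ‖v‖ ^ 2))) =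
        ‖v - x • u‖ ^ 2 - r ^ 2 := by
    linear_combination mul_norm_sub_sq_sub_eq u v x + hr - (1 - ‖v‖ ^ 2) * hx
  refine ⟨hlt, Set.ext fun v => ?_, Set.ext fun v => ?_⟩
  · have hiff (hv : v ∈ Dee) : distH u v < ρ ↔ v ∈ ball (x • u) r := by
      rw [distH_lt_iff hu hv hρ, mem_ball_iff_norm, ← sq_lt_sq₀ (norm_nonneg _) hr₀, ← sub_neg,
        ← sub_neg (a := ‖v - x • u‖ ^ 2), ← hpencil]
      exact (smul_neg_iff_of_pos_left hx₀).symm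
    exact ⟨fun h => (hiff h.1).1 h.2, fun h =>
      have hv := hDee (ball_subset_closedBall h); ⟨hv, (hiff hv).2 h⟩⟩
  · have hiff (hv : v ∈ Dee) : distH u v = ρ ↔ v ∈ sphere (x • u) r := by
      rw [distH_eq_iff hu hv hρ, mem_sphere_iff_norm, ← sq_eq_sq₀ (norm_nonneg _) hr₀,
        ← sub_eq_zero, ← sub_eq_zero (a := ‖v - x • u‖ ^ 2), ← hpencil,
        mul_eq_zero_iff_left hx₀.ne']
    exact ⟨fun h => (hiff h.1).1 h.2, fun h =>
      have hv := hDee (sphere_subset_closedBall h); ⟨hv, (hiff hv).2 h⟩⟩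

theorem exists_ball_eq_ballH (hu : u ∈ Dee) (hρ : 0 ≤ ρ) :
    ∃ (c : Plane) (r : ℝ), ‖c‖ + r < 1 ∧ ballH u ρ = ball c r ∧ sphereH u ρ = sphere c r := by
  have hu' := one_sub_norm_sq_pos (mem_Dee.1 hu)
  set q : ℝ := Real.sinh (ρ / 2) ^ 2 * (1 - ‖u‖ ^ 2)
  have hq : 0 ≤ q := by positivity
  set x : ℝ := (1 + q)⁻¹
  have hx : x ≤ 1 := inv_le_one_of_one_le₀ (by linarith)
  have hr : 0 ≤ (1 - x) * (1 - x * ‖u‖ ^ 2) :=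
    mul_nonneg (sub_nonneg.2 hx) (sub_nonneg.2 (mul_le_one₀ hx (sq_nonneg _) (by linarith)))
  exact ⟨x • u, √((1 - x) * (1 - x * ‖u‖ ^ 2)), ballH_eq_ball_and_sphereH_eq_sphere hu hρ
    (Real.sqrt_nonneg _) (inv_mul_cancel₀ (by positivity)) (Real.sq_sqrt hr)⟩

-- The condition on `x` says that `x⁻¹ • c` is the hyperbolic centre of the disk with Euclidean
-- centre `c` and radius `r`, where `a = ‖c‖`.
theorem exists_hyperbolic_center_ratio {a r : ℝ} (ha : 0 ≤ a) (hr : 0 ≤ r) (har : a + r < 1) :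
    ∃ x, a < x ∧ x ≤ 1 ∧ x * r ^ 2 = (1 - x) * (x - a ^ 2) := by
  set b : ℝ := 1 + a ^ 2 - r ^ 2 with hb
  have hab : 2 * a < b := by nlinarith
  have hD : 0 ≤ b ^ 2 - 4 * a ^ 2 := by nlinarith
  have hD' : √(b ^ 2 - 4 * a ^ 2) ≤ 2 - b := Real.sqrt_le_iff.2 ⟨by nlinarith, by nlinarith⟩
  refine ⟨(b + √(b ^ 2 - 4 * a ^ 2)) / 2, ?_, ?_, ?_⟩
  · linarith [Real.sqrt_nonneg (b ^ 2 - 4 * a ^ 2)]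
  · linarith
  · linear_combination Real.sq_sqrt hD / 4 - (b + √(b ^ 2 - 4 * a ^ 2)) / 2 * hb

theorem exists_ballH_eq_ball {c : Plane} (hr : 0 ≤ r) (hcr : ‖c‖ + r < 1) :
    ∃ u ∈ Dee, ∃ ρ, 0 ≤ ρ ∧ ballH u ρ = ball c r ∧ sphereH u ρ = sphere c r := by
  obtain ⟨x, hcx, hx₁, hxr⟩ := exists_hyperbolic_center_ratio (norm_nonneg c) hr hcr
  have hx₀ : 0 < x := (norm_nonneg c).trans_lt hcx
  have hnorm : ‖x⁻¹ • c‖ = x⁻¹ * ‖c‖ := by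
    rw [norm_smul, Real.norm_of_nonneg (inv_nonneg.2 hx₀.le)]
  have hu : x⁻¹ • c ∈ Dee := by rwa [mem_Dee, hnorm, inv_mul_lt_one₀ hx₀]
  have hu' := one_sub_norm_sq_pos (mem_Dee.1 hu)
  set q : ℝ := (1 - x) / (x * (1 - ‖x⁻¹ • c‖ ^ 2))
  have hq : 0 ≤ q := div_nonneg (sub_nonneg.2 hx₁) (by positivity)
  have hρ : 0 ≤ 2 * Real.arsinh √q :=
    mul_nonneg zero_le_two (Real.arsinh_nonneg_iff.2 (Real.sqrt_nonneg q))
  have hx : x * (1 + Real.sinh (2 * Real.arsinh √q / 2) ^ 2 * (1 - ‖x⁻¹ • c‖ ^ 2)) = 1 := by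
    rw [mul_div_cancel_left₀ _ two_ne_zero, Real.sinh_arsinh, Real.sq_sqrt hq]
    simp only [q]
    rw [div_mul_eq_mul_div, mul_div_mul_right _ _ hu'.ne']
    field_simp
    ring
  have hr' : r ^ 2 = (1 - x) * (1 - x * ‖x⁻¹ • c‖ ^ 2) := by
    rw [hnorm]
    field_simp
    linear_combination hxr
  have h := ballH_eq_ball_and_sphereH_eq_sphere hu hρ hr hx hr'
  rw [smul_inv_smul₀ hx₀.ne'] at h
  exact ⟨x⁻¹ • c, hu, 2 * Real.arsinh √q, hρ, h.2⟩

end EuclideanDisk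

/-! ### Touching cells and empty disks -/

theorem eq_iInf_and_eq_iInf_iff {α β : Type*} [ConditionallyCompleteLattice β] {f : α → β}
    {Z : Set α} (hf : BddBelow (f '' Z)) {z₁ z₂ : α} (h₁ : z₁ ∈ Z) :
    ((f z₁ = ⨅ z : Z, f z) ∧ f z₂ = ⨅ z : Z, f z) ↔
      ∃ ρ, f z₁ = ρ ∧ f z₂ = ρ ∧ ∀ z ∈ Z, ρ ≤ f z := by
  rw [← sInf_image']
  constructor
  · exact fun ⟨e₁, e₂⟩ => ⟨_, e₁, e₂, fun z hz => csInf_le hf ⟨z, hz, rfl⟩⟩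
  · rintro ⟨ρ, rfl, e₂, hle⟩
    have hleast : IsLeast (f '' Z) (f z₁) := ⟨⟨z₁, h₁, rfl⟩, Set.forall_mem_image.2 hle⟩
    exact ⟨hleast.csInf_eq.symm, e₂.trans hleast.csInf_eq.symm⟩

theorem touch_cellR_iff {Z : Set Plane} {z₁ z₂ : Plane} (h₁ : z₁ ∈ Z) :
    Touch (cellR Z z₁) (cellR Z z₂) ↔
      ∃ c r, z₁ ∈ sphere c r ∧ z₂ ∈ sphere c r ∧ Disjoint Z (ball c r) := by
  refine exists_congr fun c => ?_
  have hbdd : BddBelow ((fun z => ‖c - z‖) '' Z) :=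
    ⟨0, Set.forall_mem_image.2 fun z _ => norm_nonneg _⟩
  simp only [mem_sphere', dist_eq_norm, Set.disjoint_left, mem_ball_iff_norm', not_lt]
  exact eq_iInf_and_eq_iInf_iff hbdd h₁

theorem touch_cellH_iff_exists_ballH {Z : Set Plane} (hZ : Z ⊆ Dee) {z₁ z₂ : Plane} (h₁ : z₁ ∈ Z)
    (h₂ : z₂ ∈ Z) :
    Touch (cellH Z z₁) (cellH Z z₂) ↔
      ∃ u ∈ Dee, ∃ ρ, 0 ≤ ρ ∧ z₁ ∈ sphereH u ρ ∧ z₂ ∈ sphereH u ρ ∧ Disjoint Z (ballH u ρ) := by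
  have hbdd (u : Plane) : BddBelow (distH u '' Z) :=
    ⟨0, Set.forall_mem_image.2 fun z _ => distH_nonneg u z⟩
  constructor
  · rintro ⟨u, ⟨hu, e₁⟩, -, e₂⟩
    obtain ⟨ρ, rfl, hρ, hle⟩ := (eq_iInf_and_eq_iInf_iff (hbdd u) h₁).1 ⟨e₁, e₂⟩
    exact ⟨u, hu, _, distH_nonneg u z₁, ⟨hZ h₁, rfl⟩, ⟨hZ h₂, hρ⟩,
      Set.disjoint_left.2 fun z hz hzu => (hle z hz).not_gt hzu.2⟩
  · rintro ⟨u, hu, ρ, -, ⟨-, hρ₁⟩, ⟨-, hρ₂⟩, hdisj⟩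
    obtain ⟨e₁, e₂⟩ := (eq_iInf_and_eq_iInf_iff (hbdd u) h₁).2 ⟨ρ, hρ₁, hρ₂, fun z hz =>
      not_lt.1 fun hlt => Set.disjoint_left.1 hdisj hz ⟨hZ hz, hlt⟩⟩
    exact ⟨u, ⟨hu, e₁⟩, hu, e₂⟩

theorem touch_cellH_iff {Z : Set Plane} (hZ : Z ⊆ Dee) {z₁ z₂ : Plane} (h₁ : z₁ ∈ Z)
    (h₂ : z₂ ∈ Z) :
    Touch (cellH Z z₁) (cellH Z z₂) ↔
      ∃ c r, ‖c‖ + r < 1 ∧ z₁ ∈ sphere c r ∧ z₂ ∈ sphere c r ∧ Disjoint Z (ball c r) := by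
  rw [touch_cellH_iff_exists_ballH hZ h₁ h₂]
  constructor
  · rintro ⟨u, hu, ρ, hρ, h⟩
    obtain ⟨c, r, hcr, hball, hsphere⟩ := exists_ball_eq_ballH hu hρ
    exact ⟨c, r, hcr, by rwa [hball, hsphere] at h⟩
  · rintro ⟨c, r, hcr, h⟩
    have hr : 0 ≤ r := dist_nonneg.trans_eq (mem_sphere.1 h.1)
    obtain ⟨u, hu, ρ, hρ, hball, hsphere⟩ := exists_ballH_eq_ball hr hcr
    exact ⟨u, hu, ρ, hρ, by rwa [hball, hsphere]⟩

/-! ### Horoballs -/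

section Horoball

variable {E : Type*} [NormedAddCommGroup E] [NormedSpace ℝ E]

/-- For a unit vector `ξ` and `0 < s < 1`, the horoball of Euclidean radius `s` of the unit ball
model of hyperbolic space, tangent to the unit sphere at `ξ`. -/
def horoball (ξ : E) (s : ℝ) : Set E := ball ((1 - s) • ξ) s

variable {ξ : E} {s : ℝ}

theorem horoball_subset_ball (hξ : ‖ξ‖ = 1) {a r : ℝ} (h : s + |1 - s - a| ≤ r) :
    horoball ξ s ⊆ ball (a • ξ) r := by
  refine ball_subset_ball' ?_
  rwa [dist_eq_norm, ← sub_smul, norm_smul, hξ, mul_one, Real.norm_eq_abs]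

theorem horoball_subset_horoball (hξ : ‖ξ‖ = 1) {t : ℝ} (hst : s ≤ t) :
    horoball ξ s ⊆ horoball ξ t :=
  horoball_subset_ball hξ (by rw [abs_of_nonneg] <;> linarith)

theorem ball_subset_horoball {η : E} {ε : ℝ} (hs₀ : 0 ≤ s) (hs : s ≤ 1) (h : dist ξ η ≤ ε) :
    ball ((1 - s) • η) (s - ε) ⊆ horoball ξ s := by
  refine ball_subset_ball' ?_
  rw [dist_smul₀, Real.norm_of_nonneg (sub_nonneg.2 hs), dist_comm]
  nlinarith [dist_nonneg (x := ξ) (y := η)]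

theorem ball_subset_unitBall (hξ : ‖ξ‖ = 1) (hs : s ≤ 1) {ε : ℝ} (hε : 0 ≤ ε) :
    ball ((1 - s) • ξ) (s - ε) ⊆ ball 0 1 := by
  refine ball_subset_ball' ?_
  rw [dist_zero_right, norm_smul, hξ, Real.norm_of_nonneg (sub_nonneg.2 hs)]
  linarith

theorem exists_horoball_subset_ball {c z : E} {r : ℝ} (hz : ‖z‖ < 1) (hzr : z ∈ sphere c r)
    (h : 1 ≤ ‖c‖ + r) : ∃ s, 0 < s ∧ ∃ ξ : E, ‖ξ‖ = 1 ∧ horoball ξ s ⊆ ball c r := by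
  have hr : ‖c - z‖ = r := (dist_eq_norm c z).symm.trans (mem_sphere'.1 hzr)
  have hc : c ≠ 0 := by
    rintro rfl
    rw [zero_sub, norm_neg] at hr
    linarith [norm_zero (E := E)]
  have hcr : ‖c‖ < r + 1 := by linarith [norm_sub_norm_le c z]
  have hξ : ‖‖c‖⁻¹ • c‖ = 1 := norm_smul_inv_norm hc
  -- The largest horoball about the direction of `c`: it touches the sphere from inside.
  refine ⟨(r + 1 - ‖c‖) / 2, by linarith, ‖c‖⁻¹ • c, hξ, ?_⟩
  have hsub := horoball_subset_ball hξ (s := (r + 1 - ‖c‖) / 2) (a := ‖c‖) (r := r)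
    (by rw [abs_of_nonpos] <;> linarith)
  rwa [smul_inv_smul₀ (norm_ne_zero_iff.2 hc)] at hsub

end Horoball

theorem touch_cellR_iff_touch_cellH {Z : Set Plane} (hZ : Z ⊆ Dee)
    (hhoro : ∀ s, 0 < s → ∀ ξ : Plane, ‖ξ‖ = 1 → ¬ Disjoint Z (horoball ξ s))
    {z₁ z₂ : Plane} (h₁ : z₁ ∈ Z) (h₂ : z₂ ∈ Z) :
    Touch (cellR Z z₁) (cellR Z z₂) ↔ Touch (cellH Z z₁) (cellH Z z₂) := by
  rw [touch_cellR_iff h₁, touch_cellH_iff hZ h₁ h₂]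
  refine exists₂_congr fun c r => ⟨fun h => ⟨?_, h⟩, And.right⟩
  by_contra! hcr
  obtain ⟨s, hs, ξ, hξ, hsub⟩ := exists_horoball_subset_ball (mem_Dee.1 (hZ h₁)) h.1 hcr
  exact hhoro s hs ξ hξ (h.2.2.mono_right hsub)

/-! ### Hyperbolic area near the unit circle -/

theorem exists_orthonormalBasis_apply_eq {𝕜 ι E : Type*} [RCLike 𝕜] [NormedAddCommGroup E]
    [InnerProductSpace 𝕜 E] [FiniteDimensional 𝕜 E] [Fintype ι]
    (hcard : Module.finrank 𝕜 E = Fintype.card ι) (i : ι) {ξ : E} (hξ : ‖ξ‖ = 1) :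
    ∃ b : OrthonormalBasis ι 𝕜 E, b i = ξ := by
  have h : Orthonormal 𝕜 (({i} : Set ι).domRestrict fun _ => ξ) :=
    ⟨fun _ => hξ, fun j k hjk => (hjk (Subsingleton.elim j k)).elim⟩
  obtain ⟨b, hb⟩ := h.exists_orthonormalBasis_extension_of_card_eq hcard
  exact ⟨b, hb i rfl⟩

theorem volume_setOf_forall_repr_mem {ι E : Type*} [Fintype ι] [NormedAddCommGroup E]
    [InnerProductSpace ℝ E] [FiniteDimensional ℝ E] [MeasurableSpace E] [BorelSpace E]
    (b : OrthonormalBasis ι ℝ E) (s : ι → Set ℝ) :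
    volume {u | ∀ i, b.repr u i ∈ s i} = ∏ i, volume (s i) := by
  have hmp := b.measurePreserving_measurableEquiv.trans
    (EuclideanSpace.volume_preserving_symm_measurableEquiv_toLp ι)
  rw [← volume_pi_pi, ← hmp.measure_preimage_equiv]
  congr 1
  ext u
  simp [Set.mem_pi, OrthonormalBasis.measurableEquiv]

section BoundaryBox

variable {E : Type*} [NormedAddCommGroup E] [InnerProductSpace ℝ E]
  (b : OrthonormalBasis (Fin 2) ℝ E) {ε w s : ℝ}

theorem norm_sub_smul_sq_eq (u : E) (a : ℝ) :
    ‖u - a • b 0‖ ^ 2 = (b.repr u 0 - a) ^ 2 + b.repr u 1 ^ 2 := by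
  rw [← b.repr.norm_map, EuclideanSpace.norm_sq_eq, Fin.sum_univ_two]
  simp [b.repr_self]

/-- The rectangle with sides parallel to the basis `b`, of depth `ε` and half-width `w`, facing the
point `b 0` of the unit circle at distance `2 * ε`. -/
def boundaryBox (ε w : ℝ) : Set E :=
  {u | ∀ i, b.repr u i ∈ ![Set.Icc (1 - 3 * ε) (1 - 2 * ε), Set.Icc (-w) w] i}

variable {b} in
theorem mem_boundaryBox {u : E} :
    u ∈ boundaryBox b ε w ↔
      b.repr u 0 ∈ Set.Icc (1 - 3 * ε) (1 - 2 * ε) ∧ b.repr u 1 ∈ Set.Icc (-w) w :=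
  Fin.forall_fin_two

theorem volume_boundaryBox [FiniteDimensional ℝ E] [MeasurableSpace E] [BorelSpace E] :
    volume (boundaryBox b ε w) = ENNReal.ofReal ε * ENNReal.ofReal (2 * w) := by
  rw [boundaryBox, volume_setOf_forall_repr_mem, Fin.prod_univ_two]
  simp only [Matrix.cons_val_zero, Matrix.cons_val_one, Real.volume_Icc]
  congr 2 <;> ring

theorem boundaryBox_subset_ball (hε : 0 < ε) (hεs : 4 * ε ≤ s) (hw : w ^ 2 ≤ ε * s / 4) :
    boundaryBox b ε w ⊆ ball ((1 - s) • b 0) (s - ε) := fun u hu => by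
  obtain ⟨⟨hl, hr⟩, hw₁, hw₂⟩ := mem_boundaryBox.1 hu
  rw [mem_ball_iff_norm, ← sq_lt_sq₀ (norm_nonneg _) (by linarith), norm_sub_smul_sq_eq]
  have : b.repr u 1 ^ 2 ≤ w ^ 2 := sq_le_sq' hw₁ hw₂
  nlinarith

theorem one_sub_norm_sq_le_of_mem_boundaryBox (hε : 3 * ε ≤ 1) {u : E}
    (hu : u ∈ boundaryBox b ε w) : 1 - ‖u‖ ^ 2 ≤ 6 * ε := by
  have hnorm := norm_sub_smul_sq_eq b u 0
  rw [zero_smul, sub_zero, sub_zero] at hnorm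
  have hle : (1 - 3 * ε) ^ 2 ≤ b.repr u 0 ^ 2 :=
    pow_le_pow_left₀ (by linarith) (mem_boundaryBox.1 hu).1.1 2
  nlinarith [sq_nonneg (b.repr u 1), sq_nonneg ε]

end BoundaryBox

theorem le_areaH_ball {ξ : Plane} (hξ : ‖ξ‖ = 1) {s ε : ℝ} (hs : s ≤ 1) (hε : 0 < ε)
    (hεs : 4 * ε ≤ s) :
    ENNReal.ofReal (√(s / ε) / 9) ≤ areaH (ball ((1 - s) • ξ) (s - ε)) := by
  obtain ⟨b, rfl⟩ := exists_orthonormalBasis_apply_eq (𝕜 := ℝ) (by simp) (0 : Fin 2) hξ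
  have hs₀ : 0 < s := by linarith
  set w : ℝ := ε / 2 * √(s / ε) with hw
  have hw₂ : w ^ 2 = ε * s / 4 := by
    rw [hw, mul_pow, Real.sq_sqrt (by positivity)]
    field_simp
    norm_num
  have hsub := boundaryBox_subset_ball b hε hεs hw₂.le
  have hdens : ∀ u ∈ boundaryBox b ε w,
      ENNReal.ofReal (1 / (9 * ε ^ 2)) ≤ ENNReal.ofReal (4 / (1 - ‖u‖ ^ 2) ^ 2) := fun u hu => by
    have hpos := one_sub_norm_sq_pos (mem_Dee.1 (ball_subset_unitBall hξ hs hε.le (hsub hu)))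
    have hle := one_sub_norm_sq_le_of_mem_boundaryBox b (by linarith) hu
    refine ENNReal.ofReal_le_ofReal ?_
    calc 1 / (9 * ε ^ 2) = 4 / (6 * ε) ^ 2 := by field_simp; norm_num
      _ ≤ 4 / (1 - ‖u‖ ^ 2) ^ 2 := by gcongr
  calc ENNReal.ofReal (√(s / ε) / 9)
      = ENNReal.ofReal (1 / (9 * ε ^ 2)) * volume (boundaryBox b ε w) := by
        rw [volume_boundaryBox, ← ENNReal.ofReal_mul hε.le, ← ENNReal.ofReal_mul (by positivity)]
        congr 1
        rw [hw]
        field_simp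
    _ = ∫⁻ _ in boundaryBox b ε w, ENNReal.ofReal (1 / (9 * ε ^ 2)) := (setLIntegral_const _ _).symm
    _ ≤ ∫⁻ u in boundaryBox b ε w, ENNReal.ofReal (4 / (1 - ‖u‖ ^ 2) ^ 2) :=
        setLIntegral_mono (by fun_prop) hdens
    _ ≤ areaH (ball ((1 - s) • b 0) (s - ε)) := lintegral_mono_set hsub

/-! ### No horodisk is empty -/

/-- The point of the unit circle with polar angle `θ`. -/
noncomputable def circlePoint (θ : ℝ) : Plane :=
  Complex.orthonormalBasisOneI.repr (Complex.exp (θ * Complex.I))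

theorem norm_circlePoint (θ : ℝ) : ‖circlePoint θ‖ = 1 := by
  rw [circlePoint, LinearIsometryEquiv.norm_map, Complex.norm_exp_ofReal_mul_I]

theorem dist_circlePoint_le (θ φ : ℝ) : dist (circlePoint θ) (circlePoint φ) ≤ |θ - φ| := by
  have h : Complex.exp (θ * Complex.I) - Complex.exp (φ * Complex.I) =
      Complex.exp (φ * Complex.I) * (Complex.exp (Complex.I * (θ - φ : ℝ)) - 1) := by
    rw [mul_sub, ← Complex.exp_add, mul_one]
    push_cast
    ring_nf
  rw [circlePoint, circlePoint, LinearIsometryEquiv.dist_map, dist_eq_norm, h, norm_mul,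
    Complex.norm_exp_ofReal_mul_I, one_mul]
  exact Real.norm_exp_I_mul_ofReal_sub_one_le

theorem exists_eq_circlePoint {ξ : Plane} (hξ : ‖ξ‖ = 1) :
    ∃ θ ∈ Set.Ioc (-Real.pi) Real.pi, circlePoint θ = ξ := by
  rw [← Complex.orthonormalBasisOneI.repr.symm.norm_map, Complex.norm_eq_one_iff'] at hξ
  obtain ⟨θ, hθ, h⟩ := hξ
  exact ⟨θ, hθ, (LinearIsometryEquiv.eq_symm_apply _).1 h⟩

theorem exists_finset_net_unitCircle {ε : ℝ} (hε : 0 < ε) (hε₁ : ε ≤ 1) :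
    ∃ T : Finset Plane, (T.card : ℝ) ≤ 9 / ε ∧ (∀ η ∈ T, ‖η‖ = 1) ∧
      ∀ ξ : Plane, ‖ξ‖ = 1 → ∃ η ∈ T, dist ξ η ≤ ε := by
  classical
  set K : Finset ℤ := Finset.Icc ⌊-Real.pi / ε⌋ ⌊Real.pi / ε⌋
  refine ⟨K.image fun k : ℤ => circlePoint (k * ε), ?_, ?_, fun ξ hξ => ?_⟩
  · have hK : (K.card : ℝ) = ⌊Real.pi / ε⌋ + 1 - ⌊-Real.pi / ε⌋ := by
      have : ⌊-Real.pi / ε⌋ ≤ ⌊Real.pi / ε⌋ :=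
        Int.floor_mono (by gcongr; linarith [Real.pi_pos])
      exact_mod_cast Int.card_Icc_of_le _ _ (by lia)
    calc ((K.image fun k : ℤ => circlePoint (k * ε)).card : ℝ)
        ≤ K.card := by exact_mod_cast Finset.card_image_le
      _ ≤ Real.pi / ε + 1 - (-Real.pi / ε - 1) := by
        rw [hK]
        linarith [Int.floor_le (Real.pi / ε), Int.sub_one_lt_floor (-Real.pi / ε)]
      _ = (2 * Real.pi + 2 * ε) / ε := by field_simp; ring
      _ ≤ 9 / ε := by gcongr; linarith [Real.pi_lt_d2]
  · simp only [Finset.forall_mem_image, norm_circlePoint, implies_true]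
  · obtain ⟨θ, ⟨hθ₁, hθ₂⟩, rfl⟩ := exists_eq_circlePoint hξ
    refine ⟨_, Finset.mem_image_of_mem _ (Finset.mem_Icc.2 ⟨Int.floor_mono ?_, Int.floor_mono ?_⟩),
      (dist_circlePoint_le θ (⌊θ / ε⌋ * ε)).trans ?_⟩
    · gcongr
    · gcongr
    · have h : θ - ⌊θ / ε⌋ * ε = Int.fract (θ / ε) * ε := by
        rw [Int.fract]
        field_simp
      rw [h, abs_of_nonneg (mul_nonneg (Int.fract_nonneg _) hε.le)]
      exact mul_le_of_le_one_left hε.le (Int.fract_lt_one _).le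

theorem tendsto_inv_mul_exp_neg_sqrt_nhdsGT {a C s : ℝ} (ha : 0 < a) (hs : 0 < s) :
    Tendsto (fun ε => C / ε * Real.exp (-(a * √(s / ε)))) (𝓝[>] 0) (𝓝 0) := by
  have hy : Tendsto (fun ε => a * √(s / ε)) (𝓝[>] 0) atTop :=
    (Real.tendsto_sqrt_atTop.comp (tendsto_inv_nhdsGT_zero.const_mul_atTop hs)).const_mul_atTop ha
  have h := ((Real.tendsto_pow_mul_exp_neg_atTop_nhds_zero 2).comp hy).const_mul (C / (a ^ 2 * s))
  rw [mul_zero] at h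
  refine h.congr' ?_
  filter_upwards [self_mem_nhdsWithin] with ε hε
  have hε' : 0 < ε := hε
  rw [Function.comp_apply, mul_pow, Real.sq_sqrt (by positivity)]
  field_simp

section VoidProbability

variable {Ω : Type*} [MeasurableSpace Ω] {P : Measure Ω} {lam : ℝ} {Z : Ω → Set Plane}

theorem poissonLaw_singleton_zero (r : ℝ≥0∞) : poissonLaw r {0} = EReal.exp (-(r : EReal)) := by
  unfold poissonLaw
  split_ifs with hr
  · simp [hr]
  · have hpre : ((↑) : ℕ → ℕ∞) ⁻¹' {0} = {0} := by ext; simp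
    lift r to ℝ≥0 using hr
    rw [Measure.map_apply (measurable_of_countable _) (measurableSet_singleton _), hpre,
      poissonMeasure_singleton, ENNReal.toNNReal_coe, pow_zero, Nat.factorial_zero, Nat.cast_one,
      mul_one, div_one, ← EReal.exp_coe, EReal.coe_neg]
    rfl

theorem IsHyperbolicPPP.measure_disjoint (hZ : IsHyperbolicPPP P lam Z) {A : Set Plane}
    (hA : MeasurableSet A) (hAD : A ⊆ Dee) :
    P {ω | Disjoint (Z ω) A} =
      EReal.exp (-((ENNReal.ofReal lam * areaH A : ℝ≥0∞) : EReal)) := by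
  have h : {ω | Disjoint (Z ω) A} = (fun ω => count (Z ω) A) ⁻¹' {0} := by
    ext ω
    simp [count, Set.disjoint_iff_inter_eq_empty]
  rw [h, ← Measure.map_apply (hZ.measurable_count A hA hAD) (measurableSet_singleton _),
    hZ.law_count A hA hAD, poissonLaw_singleton_zero]

variable (hvoid : ∀ A, MeasurableSet A → A ⊆ Dee →
  P {ω | Disjoint (Z ω) A} ≤ EReal.exp (-((ENNReal.ofReal lam * areaH A : ℝ≥0∞) : EReal)))
include hvoid

theorem measure_disjoint_ball_le (hlam : 0 ≤ lam) {ξ : Plane} (hξ : ‖ξ‖ = 1) {s ε : ℝ}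
    (hs : s ≤ 1) (hε : 0 < ε) (hεs : 4 * ε ≤ s) :
    P {ω | Disjoint (Z ω) (ball ((1 - s) • ξ) (s - ε))} ≤
      ENNReal.ofReal (Real.exp (-(lam / 9 * √(s / ε)))) := by
  refine (hvoid _ measurableSet_ball (ball_subset_unitBall hξ hs hε.le)).trans ?_
  rw [← EReal.exp_coe, EReal.exp_le_exp_iff, EReal.coe_neg, EReal.neg_le_neg_iff,
    ← max_eq_left (b := 0) (show 0 ≤ lam / 9 * √(s / ε) by positivity), ← EReal.coe_ennreal_ofReal,
    EReal.coe_ennreal_le_coe_ennreal_iff]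
  calc ENNReal.ofReal (lam / 9 * √(s / ε))
      = ENNReal.ofReal lam * ENNReal.ofReal (√(s / ε) / 9) := by
        rw [← ENNReal.ofReal_mul hlam]
        congr 1
        ring
    _ ≤ ENNReal.ofReal lam * areaH (ball ((1 - s) • ξ) (s - ε)) := by
        gcongr
        exact le_areaH_ball hξ hs hε hεs

theorem measure_exists_disjoint_horoball_le (hlam : 0 ≤ lam) {s ε : ℝ} (hs : s ≤ 1) (hε : 0 < ε)
    (hεs : 4 * ε ≤ s) :
    P {ω | ∃ ξ : Plane, ‖ξ‖ = 1 ∧ Disjoint (Z ω) (horoball ξ s)} ≤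
      ENNReal.ofReal (9 / ε * Real.exp (-(lam / 9 * √(s / ε)))) := by
  obtain ⟨T, hcard, hT, hnet⟩ := exists_finset_net_unitCircle hε (by linarith)
  have hsub : {ω | ∃ ξ : Plane, ‖ξ‖ = 1 ∧ Disjoint (Z ω) (horoball ξ s)} ⊆
      ⋃ η ∈ T, {ω | Disjoint (Z ω) (ball ((1 - s) • η) (s - ε))} := by
    rintro ω ⟨ξ, hξ, hdisj⟩
    obtain ⟨η, hη, hdist⟩ := hnet ξ hξ
    exact Set.mem_biUnion hη (hdisj.mono_right (ball_subset_horoball (by linarith) hs hdist))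
  calc P {ω | ∃ ξ : Plane, ‖ξ‖ = 1 ∧ Disjoint (Z ω) (horoball ξ s)}
      ≤ ∑ η ∈ T, P {ω | Disjoint (Z ω) (ball ((1 - s) • η) (s - ε))} :=
        (measure_mono hsub).trans (measure_biUnion_finset_le _ _)
    _ ≤ T.card • ENNReal.ofReal (Real.exp (-(lam / 9 * √(s / ε)))) :=
        Finset.sum_le_card_nsmul _ _ _ fun η hη =>
          measure_disjoint_ball_le hvoid hlam (hT η hη) hs hε hεs
    _ = ENNReal.ofReal (T.card * Real.exp (-(lam / 9 * √(s / ε)))) := by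
        rw [← ENNReal.ofReal_nsmul, nsmul_eq_mul]
    _ ≤ ENNReal.ofReal (9 / ε * Real.exp (-(lam / 9 * √(s / ε)))) := by gcongr

theorem ae_forall_not_disjoint_horoball_of_le_one (hlam : 0 < lam) {s : ℝ} (hs₀ : 0 < s)
    (hs : s ≤ 1) : ∀ᵐ ω ∂P, ∀ ξ : Plane, ‖ξ‖ = 1 → ¬ Disjoint (Z ω) (horoball ξ s) := by
  have hlim := ENNReal.tendsto_ofReal
    (tendsto_inv_mul_exp_neg_sqrt_nhdsGT (a := lam / 9) (C := 9) (by positivity) hs₀)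
  rw [ENNReal.ofReal_zero] at hlim
  rw [ae_iff]
  push Not
  refine nonpos_iff_eq_zero.1 (ge_of_tendsto hlim ?_)
  filter_upwards [Ioo_mem_nhdsGT (show 0 < s / 4 by positivity)] with ε hε
  exact measure_exists_disjoint_horoball_le hvoid hlam.le hs hε.1 (by linarith [hε.2])

theorem ae_forall_not_disjoint_horoball (hlam : 0 < lam) :
    ∀ᵐ ω ∂P, ∀ s, 0 < s → ∀ ξ : Plane, ‖ξ‖ = 1 → ¬ Disjoint (Z ω) (horoball ξ s) := by
  have hae : ∀ᵐ ω ∂P, ∀ n : ℕ, ∀ ξ : Plane, ‖ξ‖ = 1 →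
      ¬ Disjoint (Z ω) (horoball ξ (1 / ((n : ℝ) + 1))) :=
    ae_all_iff.2 fun n => ae_forall_not_disjoint_horoball_of_le_one hvoid hlam
      Nat.one_div_pos_of_nat (div_le_one_of_le₀ (by linarith [n.cast_nonneg (α := ℝ)])
        (by positivity))
  filter_upwards [hae] with ω hω s hs ξ hξ hdisj
  obtain ⟨n, hn⟩ := exists_nat_one_div_lt hs
  exact hω n ξ hξ (hdisj.mono_right (horoball_subset_horoball hξ hn.le))

end VoidProbability

end HypVoronoi

open HypVoronoi in
theorem lemma2_general {Ω : Type*} [MeasurableSpace Ω] (P : Measure Ω) (lam : ℝ) (hlam : 0 < lam)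
    (Z : Ω → Set Plane) (hZ : ∀ᵐ ω ∂P, Z ω ⊆ Dee)
    (hvoid : ∀ A, MeasurableSet A → A ⊆ Dee →
      P {ω | Disjoint (Z ω) A} ≤
        EReal.exp (-((ENNReal.ofReal lam * areaH A : ℝ≥0∞) : EReal))) :
    ∀ᵐ ω ∂P, ∀ z₁ ∈ Z ω, ∀ z₂ ∈ Z ω,
      (Touch (cellR (Z ω) z₁) (cellR (Z ω) z₂) ↔ Touch (cellH (Z ω) z₁) (cellH (Z ω) z₂)) := by
  filter_upwards [hZ, ae_forall_not_disjoint_horoball hvoid hlam] with ω hDee hhoro z₁ h₁ z₂ h₂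
  exact touch_cellR_iff_touch_cellH hDee hhoro h₁ h₂

theorem lemma2 {Ω : Type*} [MeasurableSpace Ω] (P : MeasureTheory.Measure Ω)
    [MeasureTheory.IsProbabilityMeasure P] (lam : ℝ) (hlam : 0 < lam)
    (Z : Ω → Set HypVoronoi.Plane) (hZ : HypVoronoi.IsHyperbolicPPP P lam Z) :
    ∀ᵐ ω ∂P, ∀ z₁ ∈ Z ω, ∀ z₂ ∈ Z ω,
      (HypVoronoi.Touch (HypVoronoi.cellR (Z ω) z₁) (HypVoronoi.cellR (Z ω) z₂) ↔
        HypVoronoi.Touch (HypVoronoi.cellH (Z ω) z₁) (HypVoronoi.cellH (Z ω) z₂)) :=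
  lemma2_general P lam hlam Z (.of_forall hZ.subset_disk)
    fun _ hA hAD => (hZ.measure_disjoint hA hAD).le
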